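/- Let $K$ be a field and let $n_1<n_2<n_3<n_4$ be positive integers with $\gcd(n_1,n_2,n_3,n_4)=1$. Let $C$ be the monomial curve $x_i=t^{n_i}$ $(1\le i\le 4)$, let $I(C)$ be the kernel of the $K$-algebra homomorphism $K[x_1,x_2,x_3,x_4]\to K[t]$, $x_i\mapsto t^{n_i}$, and let $I(C)_*$ be the ideal generated by the forms $f_*$, $f\in I(C)$, where $f_*$ is the nonzero homogeneous summand of $f$ of least degree. Suppose that $I(C)$ is minimally generated by $$f_1=x_1^{a_1}-x_2^{a_{12}}x_3^{a_{13}},\quad f_2=x_2^{a_2}-x_1^{a_{21}}x_4^{a_{24}},\quad f_3=x_3^{a_3}-x_2^{a_{32}}x_4^{a_{34}},$$ $$f_4=x_4^{a_4}-x_1^{a_{41}}x_3^{a_{43}},\quad f_5=x_1^{a_{41}}x_2^{a_{32}}-x_3^{a_{13}}x_4^{a_{24}},$$ where $0<a_{ij}<a_j$ for every exponent $a_{ij}$ that occurs. Suppose that $C$ has Cohen–Macaulay tangent cone at the origin, that is, the ring $K[x_1,x_2,x_3,x_4]/I(C)_*$ is Cohen–Macaulay. Suppose finally that $a_3>a_{32}+a_{34}$,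 $a_{34}<a_{24}$ and $a_{12}\le a_{32}$, and put $$f_6=x_3^{a_3+a_{13}}-x_1^{a_1}x_2^{a_{32}-a_{12}}x_4^{a_{34}}.$$ Then $\{f_1,\dots,f_6\}$ is a standard basis of $I(C)$ with respect to the negative degree reverse lexicographic ordering with $x_4>x_3>x_2>x_1$. Moreover $a_2\le a_{21}+a_{24}$ and $a_3+a_{13}\le a_1+a_{32}-a_{12}+a_{34}$, and: 1. If $a_2<a_{21}+a_{24}$ and $a_3+a_{13}<a_1+a_{32}-a_{12}+a_{34}$, then $I(C)_*$ is minimally generated by the six elements $x_2^{a_{12}}x_3^{a_{13}},\ x_2^{a_2},\ x_2^{a_{32}}x_4^{a_{34}},\ x_4^{a_4},\ x_3^{a_{13}}x_4^{a_{24}},\ x_3^{a_3+a_{13}}$. 2. If $a_2<a_{21}+a_{24}$ and $a_3+a_{13}=a_1+a_{32}-a_{12}+a_{34}$, then $I(C)_*$ is minimally generated by the six elements $x_2^{a_{12}}x_3^{a_{13}},\ x_2^{a_2},\ x_2^{a_{32}}x_4^{a_{34}},\ x_4^{a_4},\ x_3^{a_{13}}x_4^{a_{24}},\ x_3^{a_3+a_{13}}-x_1^{a_1}x_2^{a_{32}-a_{12}}x_4^{a_{34}}$.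 3. If $a_2=a_{21}+a_{24}$ and $a_3+a_{13}<a_1+a_{32}-a_{12}+a_{34}$, then $I(C)_*$ is minimally generated by the six elements $x_2^{a_{12}}x_3^{a_{13}},\ x_2^{a_2}-x_1^{a_{21}}x_4^{a_{24}},\ x_2^{a_{32}}x_4^{a_{34}},\ x_4^{a_4},\ x_3^{a_{13}}x_4^{a_{24}},\ x_3^{a_3+a_{13}}$. 4. If $a_2=a_{21}+a_{24}$ and $a_3+a_{13}=a_1+a_{32}-a_{12}+a_{34}$, then $I(C)_*$ is minimally generated by the six elements $x_2^{a_{12}}x_3^{a_{13}},\ x_2^{a_2}-x_1^{a_{21}}x_4^{a_{24}},\ x_2^{a_{32}}x_4^{a_{34}},\ x_4^{a_4},\ x_3^{a_{13}}x_4^{a_{24}},\ x_3^{a_3+a_{13}}-x_1^{a_1}x_2^{a_{32}-a_{12}}x_4^{a_{34}}$. -/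

import Mathlib

open MvPolynomial

namespace MonomialCurve

/-- The toric ideal `I(C)` of the affine monomial curve `x_i = t ^ n_i`: the kernel of the
`K`-algebra homomorphism `K[x_1, ..., x_d] → K[t]`, `x_i ↦ t ^ n_i`. -/
noncomputable def toricIdeal (K : Type*) [Field K] {d : ℕ} (n : Fin d → ℕ) :
    Ideal (MvPolynomial (Fin d) K) :=
  RingHom.ker (aeval (R := K) fun i : Fin d => (Polynomial.X : Polynomial K) ^ n i)

/-- `f_*`, the nonzero homogeneous summand of least degree of `f` (and `0_* = 0`). -/
noncomputable def initialForm {K σ : Type*} [Field K] (f : MvPolynomial σ K) :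
    MvPolynomial σ K :=
  homogeneousComponent (sInf {d : ℕ | homogeneousComponent d f ≠ 0}) f

/-- `I_*`, the ideal generated by the polynomials `f_*` with `f ∈ I`. For `I = I(C)` this is the
defining ideal of the tangent cone of `C` at the origin. -/
noncomputable def tangentConeIdeal {K σ : Type*} [Field K] (I : Ideal (MvPolynomial σ K)) :
    Ideal (MvPolynomial σ K) :=
  Ideal.span (initialForm '' (I : Set (MvPolynomial σ K)))

/-- The family `f` generates `I`, and no member is in the ideal generated by the others (that is,
no proper subfamily generates `I`). In particular the members are pairwise distinct. -/
def IsMinimallyGeneratedBy {R ι : Type*} [CommRing R] (I : Ideal R) (f : ι → R) : Prop :=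
  Ideal.span (Set.range f) = I ∧ ∀ i, f i ∉ Ideal.span (f '' {i}ᶜ)

/-- A Noetherian local ring is Cohen-Macaulay if its maximal ideal contains a regular sequence
whose length is the Krull dimension (depth equals dimension). -/
def IsCohenMacaulayLocal (R : Type*) [CommRing R] [IsLocalRing R] : Prop :=
  IsNoetherianRing R ∧
    ∃ rs : List R, (∀ r ∈ rs, r ∈ IsLocalRing.maximalIdeal R) ∧
      RingTheory.Sequence.IsRegular R rs ∧ ringKrullDim R = (rs.length : WithBot ℕ∞)

/-- A Noetherian ring is Cohen-Macaulay if all its localizations at prime ideals are. -/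
def IsCohenMacaulay (R : Type*) [CommRing R] : Prop :=
  IsNoetherianRing R ∧
    ∀ (p : Ideal R) [p.IsPrime], IsCohenMacaulayLocal (Localization.AtPrime p)

/-- The curve `x_i = t ^ n_i` has Cohen-Macaulay tangent cone at the origin: the coordinate ring
`K[x_1, ..., x_d] / I(C)_*` of the tangent cone is a Cohen-Macaulay ring. -/
def HasCohenMacaulayTangentCone (K : Type*) [Field K] {d : ℕ} (n : Fin d → ℕ) : Prop :=
  IsCohenMacaulay (MvPolynomial (Fin d) K ⧸ tangentConeIdeal (toricIdeal K n))

/-- `NegDegRevLexGT α β` means `x^α > x^β` in the negative degree reverse lexicographic ordering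
with `x_d > ... > x_2 > x_1`: the monomial of smaller total degree is the larger one, and in equal
degrees the larger one is that with the smaller exponent at the smallest variable (the one of least
index) where the exponents differ. -/
def NegDegRevLexGT {d : ℕ} (α β : Fin d →₀ ℕ) : Prop :=
  α.degree < β.degree ∨
    (α.degree = β.degree ∧ ∃ i, (∀ j < i, α j = β j) ∧ α i < β i)

/-- `x^α` is the leading monomial `LM(f)` of `f`: the largest monomial occurring in `f`. -/
def IsLeadingExponent {K : Type*} [Field K] {d : ℕ} (f : MvPolynomial (Fin d) K)
    (α : Fin d →₀ ℕ) : Prop :=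
  α ∈ f.support ∧ ∀ β ∈ f.support, β ≠ α → NegDegRevLexGT α β

/-- `G` is a standard basis of `I` for the negative degree reverse lexicographic ordering with
`x_d > ... > x_1`: `G` is a finite subset of `I`, and the leading monomial of every nonzero `f ∈ I`
is divisible by the leading monomial of some `g ∈ G`. (The ordering is local. Every element of the
extension of `I` to the localization of the polynomial ring at the origin becomes an element of `I`
after multiplication by a unit with leading monomial `1`, so it suffices to test elements of `I`.)
-/
def IsStandardBasis {K : Type*} [Field K] {d : ℕ} (G : Set (MvPolynomial (Fin d) K))
    (I : Ideal (MvPolynomial (Fin d) K)) : Prop :=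
  G.Finite ∧ G ⊆ (I : Set (MvPolynomial (Fin d) K)) ∧
    ∀ f ∈ I, f ≠ 0 → ∃ g ∈ G, ∃ α β : Fin d →₀ ℕ,
      IsLeadingExponent f α ∧ IsLeadingExponent g β ∧ β ≤ α

end MonomialCurve

namespace MonomialCurve

section Tangent

variable {K σ : Type*} [Field K]

theorem homogeneousComponent_mem_tangentConeIdeal {I : Ideal (MvPolynomial σ K)}
    {f : MvPolynomial σ K} (hf : f ∈ I) {d : ℕ} (h : ∀ k < d, homogeneousComponent k f = 0) :
    homogeneousComponent d f ∈ tangentConeIdeal I := by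
  by_cases h0 : homogeneousComponent d f = 0
  · rw [h0]; exact zero_mem _
  · have : sInf {k | homogeneousComponent k f ≠ 0} = d :=
      le_antisymm (Nat.sInf_le h0)
        (le_csInf ⟨d, h0⟩ fun k hk => not_lt.1 fun hlt => hk (h k hlt))
    exact Ideal.subset_span ⟨f, hf, by rw [initialForm, this]⟩

theorem homogeneousComponent_monomial_mul (γ : σ →₀ ℕ) (c : K) (f : MvPolynomial σ K) (k : ℕ) :
    homogeneousComponent k (monomial γ c * f) =
      if γ.degree ≤ k then monomial γ c * homogeneousComponent (k - γ.degree) f else 0 := by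
  classical
  ext α
  rw [coeff_homogeneousComponent, coeff_monomial_mul']
  by_cases hγ : γ ≤ α
  · obtain ⟨β, rfl⟩ := exists_add_of_le hγ
    have hd : (γ + β).degree = γ.degree + β.degree := map_add _ _ _
    by_cases hk : γ.degree ≤ k
    · simp only [if_pos hk, coeff_monomial_mul', if_pos hγ, coeff_homogeneousComponent, hd,
        add_tsub_cancel_left]
      by_cases hb : γ.degree + β.degree = k
      · rw [if_pos hb, if_pos (by omega)]
      · rw [if_neg hb, if_neg (by omega), mul_zero]
    · rw [if_neg hk, if_neg (by omega), coeff_zero]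
  · by_cases hk : γ.degree ≤ k
    · simp [hk, coeff_monomial_mul', hγ]
    · simp [hk, hγ]

theorem exists_mem_homogeneousComponent_eq {I : Ideal (MvPolynomial σ K)} {h : MvPolynomial σ K}
    (hh : h ∈ tangentConeIdeal I) (d : ℕ) :
    ∃ f ∈ I, (∀ k < d, homogeneousComponent k f = 0) ∧
      homogeneousComponent d f = homogeneousComponent d h := by
  classical
  induction hh using Submodule.span_induction generalizing d with
  | mem h hh =>
    obtain ⟨f, hf, rfl⟩ := hh
    by_cases hd : d = sInf {k : ℕ | homogeneousComponent k f ≠ 0}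
    · refine ⟨f, hf, fun k hk => ?_, ?_⟩
      · rw [hd] at hk
        simpa using Nat.notMem_of_lt_sInf hk
      · rw [initialForm, ← hd, homogeneousComponent_of_mem
          (homogeneousComponent_isHomogeneous d f), if_pos rfl]
    · refine ⟨0, zero_mem _, fun k _ => map_zero _, ?_⟩
      rw [initialForm, homogeneousComponent_of_mem (homogeneousComponent_isHomogeneous _ f),
        if_neg hd, map_zero]
  | zero => exact ⟨0, zero_mem _, fun k _ => map_zero _, rfl⟩
  | add x y _ _ hx hy =>
    obtain ⟨f, hf, hf1, hf2⟩ := hx d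
    obtain ⟨g, hg, hg1, hg2⟩ := hy d
    exact ⟨f + g, add_mem hf hg, fun k hk => by rw [map_add, hf1 k hk, hg1 k hk, add_zero],
      by rw [map_add, map_add, hf2, hg2]⟩
  | smul p x _ hx =>
    rw [smul_eq_mul]
    induction p using MvPolynomial.induction_on' with
    | monomial γ c =>
      obtain ⟨f, hf, hf1, hf2⟩ := hx (d - γ.degree)
      by_cases hγ : γ.degree ≤ d
      · refine ⟨monomial γ c * f, Ideal.mul_mem_left _ _ hf, fun k hk => ?_, ?_⟩
        · rw [homogeneousComponent_monomial_mul]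
          split_ifs with h
          · rw [hf1 _ (by omega), mul_zero]
          · rfl
        · rw [homogeneousComponent_monomial_mul, homogeneousComponent_monomial_mul, hf2]
      · exact ⟨0, zero_mem _, fun k _ => map_zero _, by
          rw [homogeneousComponent_monomial_mul, if_neg hγ, map_zero]⟩
    | add p q hp hq =>
      obtain ⟨f, hf, hf1, hf2⟩ := hp
      obtain ⟨g, hg, hg1, hg2⟩ := hq
      exact ⟨f + g, add_mem hf hg, fun k hk => by rw [map_add, hf1 k hk, hg1 k hk, add_zero],
        by rw [add_mul, map_add, map_add, hf2, hg2]⟩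

/-- A linear functional `f ↦ ∑ s ∈ S, coeff s f` that kills all monomial multiples of the
generators kills the ideal they generate. -/
theorem sum_coeff_eq_zero_of_mem_span {G : Set (MvPolynomial σ K)} (S : Finset (σ →₀ ℕ))
    (hG : ∀ g ∈ G, ∀ γ, ∑ s ∈ S, coeff s (monomial γ (1 : K) * g) = 0)
    {f : MvPolynomial σ K} (hf : f ∈ Ideal.span G) : ∑ s ∈ S, coeff s f = 0 := by
  suffices h : ∀ p, ∑ s ∈ S, coeff s (p * f) = 0 by simpa using h 1
  induction hf using Submodule.span_induction with
  | mem g hg =>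
    intro p
    induction p using MvPolynomial.induction_on' with
    | monomial γ c =>
      have : monomial γ c = C c * monomial γ (1 : K) := by rw [C_mul_monomial, mul_one]
      simp_rw [this, mul_assoc, coeff_C_mul, ← Finset.mul_sum, hG g hg, mul_zero]
    | add p q hp hq => simp_rw [add_mul, coeff_add, Finset.sum_add_distrib, hp, hq, add_zero]
  | zero => simp
  | add x y _ _ hx hy =>
    intro p; simp_rw [mul_add, coeff_add, Finset.sum_add_distrib, hx, hy, add_zero]
  | smul q x _ hx => intro p; simpa [mul_assoc] using hx (p * q)

/-- If a finite set `S` of exponents is closed under the moves `p i ↔ q i` then it is a union of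
classes of exponents modulo the ideal generated by the binomials `x ^ p i - x ^ q i`. -/
theorem mem_of_sub_mem_span {ι : Type*} {p q : ι → σ →₀ ℕ} (S : Finset (σ →₀ ℕ))
    (hS : ∀ i γ, γ + p i ∈ S ↔ γ + q i ∈ S) {α β : σ →₀ ℕ}
    (h : monomial α (1 : K) - monomial β 1 ∈
      Ideal.span (Set.range fun i => monomial (p i) (1 : K) - monomial (q i) 1))
    (hα : α ∈ S) : β ∈ S := by
  classical
  by_contra hβ
  have := sum_coeff_eq_zero_of_mem_span S (fun g hg γ => ?_) h
  · simp [coeff_monomial, hα, hβ] at this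
  · obtain ⟨i, rfl⟩ := hg
    by_cases h1 : γ + p i ∈ S
    · simp [mul_sub, monomial_mul, coeff_monomial, h1, (hS i γ).1 h1]
    · simp [mul_sub, monomial_mul, coeff_monomial, h1, mt (hS i γ).2 h1]

/-- A monomial divisible by none of the `x ^ p i`, `x ^ q i` is alone in its class. -/
theorem eq_of_sub_mem_span {ι : Type*} {p q : ι → σ →₀ ℕ} {α β : σ →₀ ℕ}
    (hp : ∀ i, ¬ p i ≤ α) (hq : ∀ i, ¬ q i ≤ α)
    (h : monomial α (1 : K) - monomial β 1 ∈
      Ideal.span (Set.range fun i => monomial (p i) (1 : K) - monomial (q i) 1)) : β = α := by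
  refine Finset.mem_singleton.1 (mem_of_sub_mem_span {α} (fun i γ => ?_) h (by simp))
  simp only [Finset.mem_singleton]
  exact ⟨fun h => absurd (h ▸ le_add_self) (hp i), fun h => absurd (h ▸ le_add_self) (hq i)⟩

/-- A class consisting of two monomials, which are related by the move `p j ↔ q j` only. -/
theorem eq_or_eq_of_sub_mem_span {ι : Type*} {p q : ι → σ →₀ ℕ} {j : ι} {μ β : σ →₀ ℕ}
    (hp : ∀ i, p i ≤ μ + p j → i = j) (hq : ∀ i, ¬ q i ≤ μ + p j)
    (hp' : ∀ i, ¬ p i ≤ μ + q j) (hq' : ∀ i, q i ≤ μ + q j → i = j)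
    (h : monomial (μ + p j) (1 : K) - monomial β 1 ∈
      Ideal.span (Set.range fun i => monomial (p i) (1 : K) - monomial (q i) 1)) :
    β = μ + p j ∨ β = μ + q j := by
  classical
  have := mem_of_sub_mem_span {μ + p j, μ + q j} (fun i γ => ?_) h (by simp)
  · simpa using this
  simp only [Finset.mem_insert, Finset.mem_singleton]
  constructor
  · rintro (h | h)
    · obtain rfl := hp i (h ▸ le_add_self)
      rw [add_right_cancel h]; exact Or.inr rfl
    · exact absurd (h ▸ le_add_self) (hp' i)
  · rintro (h | h)
    · exact absurd (h ▸ le_add_self) (hq i)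
    · obtain rfl := hq' i (h ▸ le_add_self)
      rw [add_right_cancel h]; exact Or.inl rfl

end Tangent

section Toric

variable {K : Type*} [Field K] {d : ℕ} {n : Fin d → ℕ}

theorem aeval_monomial_eq (α : Fin d →₀ ℕ) (c : K) :
    aeval (R := K) (fun i : Fin d => (Polynomial.X : Polynomial K) ^ n i) (monomial α c) =
      Polynomial.monomial (Finsupp.weight n α) c := by
  rw [aeval_monomial, Finsupp.weight_apply, ← Polynomial.C_mul_X_pow_eq_monomial,
    Polynomial.algebraMap_eq, Finsupp.sum, Finsupp.prod, ← Finset.prod_pow_eq_pow_sum]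
  simp [← pow_mul, mul_comm]

theorem sub_mem_toricIdeal_iff {α β : Fin d →₀ ℕ} :
    monomial α (1 : K) - monomial β 1 ∈ toricIdeal K n ↔
      Finsupp.weight n α = Finsupp.weight n β := by
  rw [toricIdeal, RingHom.mem_ker]
  simp only [map_sub, aeval_monomial_eq, sub_eq_zero]
  exact ⟨fun h => (Polynomial.monomial_left_inj one_ne_zero).1 h, fun h => by rw [h]⟩

theorem sum_coeff_weight_eq_zero {f : MvPolynomial (Fin d) K} (hf : f ∈ toricIdeal K n) (w : ℕ) :
    ∑ α ∈ f.support with Finsupp.weight n α = w, coeff α f = 0 := by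
  rw [toricIdeal, RingHom.mem_ker] at hf
  have h : Polynomial.coeff (aeval (R := K)
      (fun i : Fin d => (Polynomial.X : Polynomial K) ^ n i) (∑ α ∈ f.support,
        monomial α (coeff α f))) w = 0 := by
    rw [← f.as_sum, hf, Polynomial.coeff_zero]
  rw [map_sum, Polynomial.finsetSum_coeff] at h
  simpa only [aeval_monomial_eq, Polynomial.coeff_monomial, Finset.sum_filter] using h

theorem exists_ne_of_mem_support {f : MvPolynomial (Fin d) K} (hf : f ∈ toricIdeal K n)
    {α : Fin d →₀ ℕ} (hα : α ∈ f.support) :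
    ∃ β ∈ f.support, β ≠ α ∧ Finsupp.weight n β = Finsupp.weight n α := by
  by_contra! h
  have h1 := sum_coeff_weight_eq_zero hf (Finsupp.weight n α)
  rw [Finset.sum_eq_single_of_mem α (by simpa using hα) (fun β hβ hne => by
    rw [Finset.mem_filter] at hβ; exact absurd hβ.2 (h β hβ.1 hne))] at h1
  exact (mem_support_iff.1 hα) h1

theorem exists_degree_lt_of_mul_mem {s : MvPolynomial (Fin d) K} (hs : constantCoeff s ≠ 0)
    {γ : Fin d →₀ ℕ} (h : s * monomial γ 1 ∈ tangentConeIdeal (toricIdeal K n)) :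
    ∃ δ, Finsupp.weight n δ = Finsupp.weight n γ ∧ γ.degree < δ.degree := by
  classical
  obtain ⟨f, hf, hlow, hd⟩ := exists_mem_homogeneousComponent_eq h γ.degree
  have hc : ∀ α : Fin d →₀ ℕ, α.degree = γ.degree →
      coeff α f = if α = γ then constantCoeff s else 0 := by
    intro α hα
    have h1 := congrArg (coeff α) hd
    rw [mul_comm s, homogeneousComponent_monomial_mul, if_pos le_rfl, tsub_self,
      homogeneousComponent_zero, coeff_homogeneousComponent, if_pos hα] at h1
    rw [h1, mul_comm, coeff_C_mul, coeff_monomial, constantCoeff_eq]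
    simp [eq_comm]
  have hγ : γ ∈ f.support := by rw [mem_support_iff, hc γ rfl, if_pos rfl]; exact hs
  obtain ⟨δ, hδ, hne, hw⟩ := exists_ne_of_mem_support hf hγ
  refine ⟨δ, hw, lt_of_le_of_ne (not_lt.1 fun hlt => ?_) fun he => ?_⟩
  · have h1 := congrArg (coeff δ) (hlow _ hlt)
    rw [coeff_homogeneousComponent, if_pos rfl, coeff_zero] at h1
    exact (mem_support_iff.1 hδ) h1
  · exact (mem_support_iff.1 hδ) (by rw [hc δ he.symm, if_neg hne])

theorem monomial_mem_tangentConeIdeal {α β : Fin d →₀ ℕ}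
    (hw : Finsupp.weight n α = Finsupp.weight n β) (hd : α.degree < β.degree) :
    monomial α (1 : K) ∈ tangentConeIdeal (toricIdeal K n) := by
  have h := homogeneousComponent_mem_tangentConeIdeal (sub_mem_toricIdeal_iff (K := K).2 hw)
    (d := α.degree) fun k hk => by
      rw [map_sub, homogeneousComponent_of_mem (isHomogeneous_monomial _ rfl),
        homogeneousComponent_of_mem (isHomogeneous_monomial _ rfl), if_neg hk.ne,
        if_neg (hk.trans hd).ne, sub_zero]
  rwa [map_sub, homogeneousComponent_of_mem (isHomogeneous_monomial _ rfl),
        homogeneousComponent_of_mem (isHomogeneous_monomial _ rfl), if_pos rfl, if_neg hd.ne,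
        sub_zero] at h

theorem sub_mem_tangentConeIdeal {α β : Fin d →₀ ℕ}
    (hw : Finsupp.weight n α = Finsupp.weight n β) (hd : α.degree = β.degree) :
    monomial α (1 : K) - monomial β 1 ∈ tangentConeIdeal (toricIdeal K n) := by
  have h := homogeneousComponent_mem_tangentConeIdeal (sub_mem_toricIdeal_iff (K := K).2 hw)
    (d := α.degree) fun k hk => by
      rw [map_sub, homogeneousComponent_of_mem (isHomogeneous_monomial _ rfl),
        homogeneousComponent_of_mem (isHomogeneous_monomial _ rfl), if_neg hk.ne,
        if_neg (hd ▸ hk).ne, sub_zero]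
  rwa [map_sub, homogeneousComponent_of_mem (isHomogeneous_monomial _ rfl),
        homogeneousComponent_of_mem (isHomogeneous_monomial _ rfl), if_pos rfl, if_pos hd] at h

end Toric
end MonomialCurve

namespace MonomialCurve

section CohenMacaulay

/-- In a Cohen–Macaulay local ring which is not zero-dimensional, an element `x` such that the
maximal ideal is the radical of `(x)` is a nonzerodivisor. -/
theorem IsCohenMacaulayLocal.eq_zero_of_mul_eq_zero {R : Type*} [CommRing R] [IsLocalRing R]
    (hR : IsCohenMacaulayLocal R) {x : R} (hx : x ∈ IsLocalRing.maximalIdeal R)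
    (hnil : ¬ IsNilpotent x)
    (hrad : IsLocalRing.maximalIdeal R ≤ (Ideal.span {x}).radical) {g : R} (hg : x * g = 0) :
    g = 0 := by
  obtain ⟨-, rs, hmem, hreg, hdim⟩ := hR
  rcases rs with _ | ⟨r, rs⟩
  · exfalso
    have : Ring.KrullDimLE 0 R := by
      rw [Ring.krullDimLE_iff, hdim]; simp
    exact hnil (Ring.KrullDimLE.isNilpotent_iff_mem_maximalIdeal.2 hx)
  · obtain ⟨N, hN⟩ := hrad (hmem r (by simp))
    have hr : IsSMulRegular R r := ((RingTheory.Sequence.isRegular_cons_iff R r rs).1 hreg).1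
    obtain ⟨c, hc⟩ := Ideal.mem_span_singleton.1 hN
    apply (hr.pow N)
    simp only [smul_eq_mul, mul_zero]
    rw [hc, mul_assoc, mul_comm c, ← mul_assoc, hg, zero_mul]

variable {K σ : Type*} [Field K]

theorem exists_mul_mem_of_isCohenMacaulay {J : Ideal (MvPolynomial σ K)} {i₀ : σ}
    (hCM : IsCohenMacaulay (MvPolynomial σ K ⧸ J))
    (hJ : ∀ f ∈ J, constantCoeff f = 0)
    (hnil : ∀ k s, constantCoeff s ≠ 0 → s * X i₀ ^ k ∉ J)
    (hpow : ∀ i, ∃ k, i ≠ i₀ → X i ^ k ∈ J)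
    {h : MvPolynomial σ K} (hh : X i₀ * h ∈ J) : ∃ s, constantCoeff s ≠ 0 ∧ s * h ∈ J := by
  let φ : MvPolynomial σ K ⧸ J →+* K := Ideal.Quotient.lift J constantCoeff hJ
  let p : Ideal (MvPolynomial σ K ⧸ J) := RingHom.ker φ
  have hp : p.IsPrime := RingHom.ker_isPrime φ
  let ι := algebraMap (MvPolynomial σ K ⧸ J) (Localization.AtPrime p)
  let π := Ideal.Quotient.mk J
  have hιπ : ∀ f, ι (π f) = 0 → ∃ s, constantCoeff s ≠ 0 ∧ s * f ∈ J := by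
    intro f hf
    obtain ⟨⟨s, hs⟩, hsf⟩ := (IsLocalization.map_eq_zero_iff p.primeCompl
      (Localization.AtPrime p) (π f)).1 hf
    obtain ⟨s, rfl⟩ := Ideal.Quotient.mk_surjective s
    exact ⟨s, hs, Ideal.Quotient.eq_zero_iff_mem.1 (by rw [map_mul]; exact hsf)⟩
  have hX : ∀ i, ι (π (X i)) ∈ IsLocalRing.maximalIdeal (Localization.AtPrime p) := fun i => by
    rw [← Localization.AtPrime.map_eq_maximalIdeal]
    exact Ideal.mem_map_of_mem _ (show φ (π (X i)) = 0 by simp [φ, π])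
  apply hιπ
  refine (hCM.2 p).eq_zero_of_mul_eq_zero (hX i₀) ?_ ?_
    (by rw [← map_mul, ← map_mul, Ideal.Quotient.eq_zero_iff_mem.2 hh, map_zero])
  · rintro ⟨k, hk⟩
    rw [← map_pow, ← map_pow] at hk
    obtain ⟨s, hs, hs'⟩ := hιπ _ hk
    exact hnil k s hs hs'
  · rw [← Localization.AtPrime.map_eq_maximalIdeal, Ideal.map_le_iff_le_comap]
    intro f hf
    obtain ⟨f, rfl⟩ := Ideal.Quotient.mk_surjective f
    have hf0 : constantCoeff f = 0 := hf
    have hf : f ∈ Ideal.span (Set.range (X : σ → MvPolynomial σ K)) := by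
      rw [← Set.image_univ, mem_ideal_span_X_image]
      intro m hm
      have : m ≠ 0 := by
        rintro rfl
        exact (mem_support_iff.1 hm) hf0
      obtain ⟨i, hi⟩ := Finsupp.ne_iff.1 this
      exact ⟨i, Set.mem_univ _, hi⟩
    have hle : Ideal.span (Set.range (X : σ → MvPolynomial σ K)) ≤
        Ideal.comap (ι.comp π) (Ideal.span {ι (π (X i₀))}).radical := by
      rw [Ideal.span_le]
      rintro _ ⟨i, rfl⟩
      by_cases hi : i = i₀
      · subst hi
        exact Ideal.le_radical (Ideal.mem_span_singleton_self _)
      · obtain ⟨k, hk⟩ := hpow i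
        refine ⟨k, ?_⟩
        rw [← map_pow, RingHom.comp_apply, Ideal.Quotient.eq_zero_iff_mem.2 (hk hi), map_zero]
        exact zero_mem _
    exact hle hf

end CohenMacaulay

section Toric

variable {K : Type*} [Field K] {d : ℕ} {n : Fin d → ℕ}

theorem exists_weight_eq_degree_lt (hpos : ∀ i, 0 < n i) {i₀ : Fin d}
    (hmin : ∀ i ≠ i₀, n i₀ < n i)
    (hCM : HasCohenMacaulayTangentCone K n) (γ : Fin d →₀ ℕ) (k : ℕ)
    (h : monomial (Finsupp.single i₀ k + γ) (1 : K) ∈ tangentConeIdeal (toricIdeal K n)) :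
    ∃ δ, Finsupp.weight n δ = Finsupp.weight n γ ∧ γ.degree < δ.degree := by
  have hw : ∀ i k, Finsupp.weight n (Finsupp.single i k) = k * n i := fun i k => by
    simp [Finsupp.weight_apply]
  have hmain : ∀ f, X i₀ * f ∈ tangentConeIdeal (toricIdeal K n) →
      ∃ s, constantCoeff s ≠ 0 ∧ s * f ∈ tangentConeIdeal (toricIdeal K n) := by
    intro f
    refine exists_mul_mem_of_isCohenMacaulay hCM ?_ ?_ ?_
    · intro f hf
      by_contra hne
      obtain ⟨δ, hδ, hlt⟩ := exists_degree_lt_of_mul_mem hne (γ := 0)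
        (Ideal.mul_mem_right _ _ hf)
      rw [map_zero, Finsupp.weight_apply, Finsupp.sum, Finset.sum_eq_zero_iff] at hδ
      have : δ = 0 := by
        ext i
        by_contra hi
        have := hδ i (by simpa using hi)
        simp only [smul_eq_mul, mul_eq_zero] at this
        exact this.elim hi (hpos i).ne'
      simp [this] at hlt
    · intro k s hs hmem
      rw [X_pow_eq_monomial] at hmem
      obtain ⟨δ, hδ, hlt⟩ := exists_degree_lt_of_mul_mem hs hmem
      rw [hw, Finsupp.weight_apply, Finsupp.sum] at hδ
      rw [Finsupp.degree_single, Finsupp.degree_apply] at hlt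
      have h1 : ∑ i ∈ δ.support, δ i * n i₀ ≤ ∑ i ∈ δ.support, δ i • n i :=
        Finset.sum_le_sum fun i _ => Nat.mul_le_mul_left _ (by
          by_cases hi : i = i₀
          · rw [hi]
          · exact (hmin i hi).le)
      rw [← Finset.sum_mul, hδ] at h1
      exact absurd (Nat.le_of_mul_le_mul_right h1 (hpos i₀)) (not_le.2 hlt)
    · intro i
      refine ⟨n i₀, fun hi => ?_⟩
      rw [X_pow_eq_monomial]
      refine monomial_mem_tangentConeIdeal (β := Finsupp.single i₀ (n i)) ?_ ?_
      · rw [hw, hw, mul_comm]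
      · rw [Finsupp.degree_single, Finsupp.degree_single]; exact hmin i hi
  have hpowmain : ∀ k f, X i₀ ^ k * f ∈ tangentConeIdeal (toricIdeal K n) →
      ∃ s, constantCoeff s ≠ 0 ∧ s * f ∈ tangentConeIdeal (toricIdeal K n) := by
    intro k
    induction k with
    | zero => exact fun f hf => ⟨1, by simp, by simpa using hf⟩
    | succ k ih =>
      intro f hf
      obtain ⟨s, hs, hsf⟩ := ih (X i₀ * f) (by rwa [← mul_assoc, ← pow_succ])
      obtain ⟨s', hs', hsf'⟩ := hmain (s * f) (by rwa [mul_left_comm])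
      exact ⟨s' * s, by rw [map_mul]; exact mul_ne_zero hs' hs, by rwa [mul_assoc]⟩
  obtain ⟨s, hs, hsf⟩ := hpowmain k (monomial γ 1) (by
    rwa [X_pow_eq_monomial, monomial_mul, one_mul])
  exact exists_degree_lt_of_mul_mem hs hsf

end Toric
end MonomialCurve

namespace MonomialCurve

section Order

variable {d : ℕ}

theorem negDegRevLexGT_iff {α β : Fin d →₀ ℕ} :
    NegDegRevLexGT α β ↔
      (toLex (α.degree, toLex (⇑α)) : ℕ ×ₗ Lex (Fin d → ℕ)) < toLex (β.degree, toLex (⇑β)) := by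
  rw [Prod.Lex.toLex_lt_toLex]
  rfl

theorem NegDegRevLexGT.degree_le {α β : Fin d →₀ ℕ} (h : NegDegRevLexGT α β) :
    α.degree ≤ β.degree := by
  rcases h with h | h
  exacts [h.le, h.1.le]

theorem NegDegRevLexGT.asymm {α β : Fin d →₀ ℕ} (h : NegDegRevLexGT α β) :
    ¬ NegDegRevLexGT β α := by
  rw [negDegRevLexGT_iff] at *
  exact h.asymm

theorem NegDegRevLexGT.or_of_ne {α β : Fin d →₀ ℕ} (h : α ≠ β) :
    NegDegRevLexGT α β ∨ NegDegRevLexGT β α := by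
  rw [negDegRevLexGT_iff, negDegRevLexGT_iff]
  refine lt_or_gt_of_ne fun he => h ?_
  have := congrArg (fun x => (ofLex x).2) he
  exact DFunLike.coe_injective this

theorem NegDegRevLexGT.of_add_left {γ α β : Fin d →₀ ℕ} (h : NegDegRevLexGT (γ + α) (γ + β)) :
    NegDegRevLexGT α β := by
  rcases h with h | ⟨h, i, hi, hlt⟩
  · left; rw [map_add, map_add] at h; omega
  · right
    rw [map_add, map_add] at h
    exact ⟨by omega, i, fun j hj => by simpa using hi j hj, by simpa using hlt⟩

theorem exists_isLeadingExponent {K : Type*} [Field K] {f : MvPolynomial (Fin d) K}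
    (hf : f ≠ 0) : ∃ α, IsLeadingExponent f α := by
  obtain ⟨α, hα, hmin⟩ := Finset.exists_min_image f.support
    (fun α => (toLex (α.degree, toLex (⇑α)) : ℕ ×ₗ Lex (Fin d → ℕ))) (support_nonempty.2 hf)
  refine ⟨α, hα, fun β hβ hne => (NegDegRevLexGT.or_of_ne hne.symm).resolve_right fun h => ?_⟩
  exact (hmin β hβ).not_gt (negDegRevLexGT_iff.1 h)

theorem isLeadingExponent_sub {K : Type*} [Field K] {u v : Fin d →₀ ℕ}
    (h : NegDegRevLexGT u v) :
    IsLeadingExponent (monomial u (1 : K) - monomial v 1) u := by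
  classical
  have hne : v ≠ u := by rintro rfl; exact h.asymm h
  refine ⟨by simp [coeff_monomial, hne], fun β hβ hβu => ?_⟩
  have : β = v := by
    by_contra hβv
    simp [coeff_monomial, Ne.symm hβu, Ne.symm hβv] at hβ
  rwa [this]

theorem IsLeadingExponent.neg {K : Type*} [Field K] {f : MvPolynomial (Fin d) K} {α : Fin d →₀ ℕ}
    (h : IsLeadingExponent f α) : IsLeadingExponent (-f) α := by
  rwa [IsLeadingExponent, support_neg]

end Order

section Normal

variable {K : Type*} [Field K] {d : ℕ} {n : Fin d → ℕ} {ι : Type*} {u v : ι → Fin d →₀ ℕ}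

/-- If every monomial not divisible by one of the `x ^ u i` is the smallest one of its weight, the
binomials `± (x ^ u i - x ^ v i)` form a standard basis. -/
theorem isStandardBasis_of_normal [Finite ι] {f : ι → MvPolynomial (Fin d) K}
    (hf : ∀ i, f i = monomial (u i) 1 - monomial (v i) 1 ∨
      f i = monomial (v i) 1 - monomial (u i) 1)
    (hw : ∀ i, Finsupp.weight n (u i) = Finsupp.weight n (v i))
    (hgt : ∀ i, NegDegRevLexGT (u i) (v i))
    (hmin : ∀ α, (∀ i, ¬ u i ≤ α) → ∀ β, Finsupp.weight n β = Finsupp.weight n α → β ≠ α →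
      NegDegRevLexGT β α) :
    IsStandardBasis (Set.range f) (toricIdeal K n) := by
  refine ⟨Set.finite_range _, ?_, fun g hg hg0 => ?_⟩
  · rintro _ ⟨i, rfl⟩
    rcases hf i with h | h
    · exact h ▸ sub_mem_toricIdeal_iff.2 (hw i)
    · exact h ▸ sub_mem_toricIdeal_iff.2 (hw i).symm
  · obtain ⟨α, hα⟩ := exists_isLeadingExponent hg0
    by_cases h : ∃ i, u i ≤ α
    · obtain ⟨i, hi⟩ := h
      have hlead := isLeadingExponent_sub (K := K) (hgt i)
      refine ⟨f i, ⟨i, rfl⟩, α, u i, hα, ?_, hi⟩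
      rcases hf i with h | h
      · exact h ▸ hlead
      · rw [h, ← neg_sub]; exact hlead.neg
    · push Not at h
      obtain ⟨β, hβ, hne, hwβ⟩ := exists_ne_of_mem_support hg hα.1
      exact absurd (hα.2 β hβ hne) (hmin α h β hwβ hne).asymm

open Classical in
/-- The initial form of `x ^ α - x ^ β` if `x ^ α` is its leading monomial. -/
noncomputable def binomialInitialForm (K : Type*) [Field K] (α β : Fin d →₀ ℕ) :
    MvPolynomial (Fin d) K :=
  monomial α 1 - if α.degree = β.degree then monomial β 1 else 0

theorem binomialInitialForm_of_lt {α β : Fin d →₀ ℕ} (h : α.degree < β.degree) :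
    binomialInitialForm K α β = monomial α 1 := by
  rw [binomialInitialForm, if_neg h.ne, sub_zero]

theorem binomialInitialForm_of_eq {α β : Fin d →₀ ℕ} (h : α.degree = β.degree) :
    binomialInitialForm K α β = monomial α 1 - monomial β 1 := by
  rw [binomialInitialForm, if_pos h]

theorem binomialInitialForm_mem {α β : Fin d →₀ ℕ} (h : α.degree ≤ β.degree)
    (hw : Finsupp.weight n α = Finsupp.weight n β) :
    binomialInitialForm K α β ∈ tangentConeIdeal (toricIdeal K n) := by
  rcases h.lt_or_eq with h | h
  · rw [binomialInitialForm_of_lt h]; exact monomial_mem_tangentConeIdeal hw h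
  · rw [binomialInitialForm_of_eq h]; exact sub_mem_tangentConeIdeal hw h

/-- Reduction of a monomial by the initial forms, within its degree and weight. -/
theorem monomial_mem_or_exists_normal {i₀ : Fin d}
    (hw : ∀ i, Finsupp.weight n (u i) = Finsupp.weight n (v i))
    (hle : ∀ i, (u i).degree ≤ (v i).degree)
    (hi₀ : ∀ i, (u i).degree = (v i).degree → u i i₀ < v i i₀) (α : Fin d →₀ ℕ) :
    monomial α (1 : K) ∈ Ideal.span (Set.range fun i => binomialInitialForm K (u i) (v i)) ∨
    ∃ ν, (∀ i, ¬ u i ≤ ν) ∧ ν.degree = α.degree ∧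
      Finsupp.weight n ν = Finsupp.weight n α ∧ monomial α (1 : K) - monomial ν 1 ∈
        Ideal.span (Set.range fun i => binomialInitialForm K (u i) (v i)) := by
  induction hm : α.degree - α i₀ using Nat.strong_induction_on generalizing α with
  | _ m ih =>
  by_cases h : ∃ i, u i ≤ α
  · obtain ⟨i, hi⟩ := h
    obtain ⟨γ, rfl⟩ : ∃ γ, α = γ + u i := ⟨_, (tsub_add_cancel_of_le hi).symm⟩
    have hmem : monomial γ (1 : K) * binomialInitialForm K (u i) (v i) ∈
        Ideal.span (Set.range fun i => binomialInitialForm K (u i) (v i)) :=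
      Ideal.mul_mem_left _ _ (Ideal.subset_span ⟨i, rfl⟩)
    rcases (hle i).lt_or_eq with hlt | heq
    · rw [binomialInitialForm_of_lt hlt, monomial_mul, one_mul] at hmem
      exact Or.inl hmem
    · rw [binomialInitialForm_of_eq heq, mul_sub, monomial_mul, monomial_mul, one_mul] at hmem
      have hdeg : (γ + v i).degree = (γ + u i).degree := by rw [map_add, map_add, heq]
      have hwt : Finsupp.weight n (γ + v i) = Finsupp.weight n (γ + u i) := by
        rw [map_add, map_add, hw]
      have h1 : (γ + v i) i₀ ≤ (γ + v i).degree := Finsupp.le_degree _ _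
      have h2 : (γ + u i) i₀ < (γ + v i) i₀ := by simpa using hi₀ i heq
      rcases ih _ (by omega) (γ + v i) rfl with h3 | ⟨ν, hν, hνd, hνw, hν3⟩
      · left; simpa using add_mem hmem h3
      · right
        exact ⟨ν, hν, hνd.trans hdeg, hνw.trans hwt, by simpa using add_mem hmem hν3⟩
  · push Not at h
    exact Or.inr ⟨α, h, rfl, rfl, by simp⟩

theorem span_binomialInitialForm_eq {i₀ : Fin d}
    (hw : ∀ i, Finsupp.weight n (u i) = Finsupp.weight n (v i))
    (hle : ∀ i, (u i).degree ≤ (v i).degree)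
    (hi₀ : ∀ i, (u i).degree = (v i).degree → u i i₀ < v i i₀)
    (hmin : ∀ α, (∀ i, ¬ u i ≤ α) → ∀ β, Finsupp.weight n β = Finsupp.weight n α → β ≠ α →
      NegDegRevLexGT β α) :
    Ideal.span (Set.range fun i => binomialInitialForm K (u i) (v i)) =
      tangentConeIdeal (toricIdeal K n) := by
  classical
  set J := Ideal.span (Set.range fun i => binomialInitialForm K (u i) (v i)) with hJ
  have hJle : J ≤ tangentConeIdeal (toricIdeal K n) := by
    rw [hJ, Ideal.span_le]
    rintro _ ⟨i, rfl⟩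
    exact binomialInitialForm_mem (hle i) (hw i)
  refine le_antisymm hJle fun h hh => ?_
  rw [← sum_homogeneousComponent h]
  refine sum_mem fun e _ => ?_
  obtain ⟨f, hf, hlow, hfe⟩ := exists_mem_homogeneousComponent_eq hh e
  have hmul : ∀ (α : Fin d →₀ ℕ) (c : K), monomial α c = C c * monomial α 1 := fun α c => by
    rw [C_mul_monomial, mul_one]
  have hge : ∀ α ∈ f.support, e ≤ α.degree := fun α hα => not_lt.1 fun hlt => by
    have h1 := congrArg (coeff α) (hlow _ hlt)
    rw [coeff_homogeneousComponent, if_pos rfl, coeff_zero] at h1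
    exact (mem_support_iff.1 hα) h1
  rw [← hfe, homogeneousComponent_apply,
    ← Finset.sum_fiberwise_of_maps_to (g := Finsupp.weight n)
      (t := (f.support.filter fun α => α.degree = e).image (Finsupp.weight n))
      (fun α hα => Finset.mem_image_of_mem _ hα)]
  refine sum_mem fun w _ => ?_
  by_cases hν : ∃ ν, (∀ i, ¬ u i ≤ ν) ∧ ν.degree = e ∧ Finsupp.weight n ν = w
  · obtain ⟨ν, hν, hνe, rfl⟩ := hν
    have hmax : ∀ δ, Finsupp.weight n δ = Finsupp.weight n ν → δ.degree ≤ e := fun δ hδ => by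
      by_cases hne : δ = ν
      · rw [hne, hνe]
      · rw [← hνe]; exact (hmin ν hν δ hδ hne).degree_le
    have hred : ∀ α : Fin d →₀ ℕ, α.degree = e → Finsupp.weight n α = Finsupp.weight n ν →
        monomial α (1 : K) - monomial ν 1 ∈ J := by
      intro α hαe hαw
      rcases monomial_mem_or_exists_normal (K := K) hw hle hi₀ α with hα | ⟨μ, hμ, -, hμw, hα⟩
      · obtain ⟨δ, hδ, hlt⟩ := exists_degree_lt_of_mul_mem (s := (1 : MvPolynomial (Fin d) K))
          (by simp) (by simpa using hJle hα)
        exact absurd (hmax δ (hδ.trans hαw)) (by omega)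
      · have : μ = ν := by
          by_contra hne
          exact (hmin ν hν μ (hμw.trans hαw) hne).asymm
            (hmin μ hμ ν (hμw.trans hαw).symm (Ne.symm hne))
        rwa [this] at hα
    have hsum := sum_coeff_weight_eq_zero hf (Finsupp.weight n ν)
    have hfilter : {α ∈ {α ∈ f.support | α.degree = e} | Finsupp.weight n α = Finsupp.weight n ν}
        = {α ∈ f.support | Finsupp.weight n α = Finsupp.weight n ν} := by
      rw [Finset.filter_filter]
      refine Finset.filter_congr fun α hα => ⟨fun h => h.2, fun h => ⟨?_, h⟩⟩
      exact le_antisymm (hmax α h) (hge α hα)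
    have hzero : ∑ α ∈ {α ∈ f.support | α.degree = e} with
        Finsupp.weight n α = Finsupp.weight n ν, C (coeff α f) * monomial ν (1 : K) = 0 := by
      rw [hfilter, ← Finset.sum_mul, ← map_sum, hsum, map_zero, zero_mul]
    rw [← sub_zero (Finset.sum _ _), ← hzero, ← Finset.sum_sub_distrib]
    refine sum_mem fun α hα => ?_
    rw [Finset.mem_filter, Finset.mem_filter] at hα
    rw [hmul, ← mul_sub]
    exact Ideal.mul_mem_left _ _ (hred α hα.1.2 hα.2)
  · refine sum_mem fun α hα => ?_
    rw [Finset.mem_filter, Finset.mem_filter] at hα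
    rw [hmul]
    refine Ideal.mul_mem_left _ _ ?_
    rcases monomial_mem_or_exists_normal (K := K) hw hle hi₀ α with h1 | ⟨μ, hμ, hμd, hμw, -⟩
    · exact h1
    · exact absurd ⟨μ, hμ, hμd.trans hα.1.2, hμw.trans hα.2⟩ hν

theorem binomialInitialForm_notMem_span {i₀ : Fin d}
    (hu₀ : ∀ i, u i i₀ = 0)
    (hi₀ : ∀ i, (u i).degree = (v i).degree → 0 < v i i₀)
    (hu : ∀ i j, i ≠ j → ¬ u i ≤ u j) (i : ι) :
    binomialInitialForm K (u i) (v i) ∉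
      Ideal.span ((fun i => binomialInitialForm K (u i) (v i)) '' {i}ᶜ) := by
  classical
  intro hmem
  have htail : ∀ j γ, coeff (u i)
      (monomial γ (1 : K) * if (u j).degree = (v j).degree then monomial (v j) 1 else 0) = 0 := by
    intro j γ
    split_ifs with h
    · rw [monomial_mul, coeff_monomial, if_neg]
      intro he
      have := DFunLike.congr_fun he i₀
      rw [hu₀, Finsupp.add_apply] at this
      have := hi₀ j h
      omega
    · rw [mul_zero, coeff_zero]
  have := sum_coeff_eq_zero_of_mem_span {u i} ?_ hmem
  · rw [Finset.sum_singleton, binomialInitialForm, coeff_sub, coeff_monomial, if_pos rfl] at this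
    have h0 := htail i 0
    rw [monomial_zero', C_1, one_mul] at h0
    rw [h0, sub_zero] at this
    exact one_ne_zero this
  · rintro _ ⟨j, hj, rfl⟩ γ
    simp only [binomialInitialForm]
    rw [Finset.sum_singleton, mul_sub, coeff_sub, htail, sub_zero,
      monomial_mul, coeff_monomial, if_neg]
    intro he
    exact hu j i hj (he ▸ le_add_self)

/-- The initial forms of the binomials minimally generate the ideal of the tangent cone. -/
theorem isMinimallyGeneratedBy_binomialInitialForm {i₀ : Fin d}
    (hw : ∀ i, Finsupp.weight n (u i) = Finsupp.weight n (v i))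
    (hle : ∀ i, (u i).degree ≤ (v i).degree)
    (hu₀ : ∀ i, u i i₀ = 0)
    (hi₀ : ∀ i, (u i).degree = (v i).degree → 0 < v i i₀)
    (hu : ∀ i j, i ≠ j → ¬ u i ≤ u j)
    (hmin : ∀ α, (∀ i, ¬ u i ≤ α) → ∀ β, Finsupp.weight n β = Finsupp.weight n α → β ≠ α →
      NegDegRevLexGT β α) :
    IsMinimallyGeneratedBy (tangentConeIdeal (toricIdeal K n))
      fun i => binomialInitialForm K (u i) (v i) :=
  ⟨span_binomialInitialForm_eq hw hle (fun i h => by rw [hu₀]; exact hi₀ i h) hmin,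
    binomialInitialForm_notMem_span hu₀ hi₀ hu⟩

end Normal
end MonomialCurve

namespace MonomialCurve

section FourVariables

/-- The exponent of `x₁ ^ a * x₂ ^ b * x₃ ^ c * x₄ ^ e`. -/
noncomputable def expo (a b c e : ℕ) : Fin 4 →₀ ℕ := Finsupp.equivFunOnFinite.symm ![a, b, c, e]

@[simp] theorem expo_zero (a b c e : ℕ) : expo a b c e 0 = a := rfl
@[simp] theorem expo_one (a b c e : ℕ) : expo a b c e 1 = b := rfl
@[simp] theorem expo_two (a b c e : ℕ) : expo a b c e 2 = c := rfl
@[simp] theorem expo_three (a b c e : ℕ) : expo a b c e 3 = e := rfl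

theorem degree_fin_four (α : Fin 4 →₀ ℕ) : α.degree = α 0 + α 1 + α 2 + α 3 := by
  rw [Finsupp.degree_eq_sum, Fin.sum_univ_four]

@[simp] theorem degree_expo (a b c e : ℕ) : (expo a b c e).degree = a + b + c + e := by
  simp [degree_fin_four]

theorem weight_fin_four (n : Fin 4 → ℕ) (α : Fin 4 →₀ ℕ) :
    Finsupp.weight n α = α 0 * n 0 + α 1 * n 1 + α 2 * n 2 + α 3 * n 3 := by
  rw [Finsupp.weight_apply, Finsupp.sum_fintype _ _ (by simp), Fin.sum_univ_four]
  rfl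

theorem le_fin_four {α β : Fin 4 →₀ ℕ} :
    α ≤ β ↔ α 0 ≤ β 0 ∧ α 1 ≤ β 1 ∧ α 2 ≤ β 2 ∧ α 3 ≤ β 3 := by
  rw [Finsupp.le_def]
  simp [Fin.forall_fin_succ]

theorem monomial_expo (K : Type*) [Field K] (a b c e : ℕ) :
    monomial (expo a b c e) (1 : K) = X 0 ^ a * X 1 ^ b * X 2 ^ c * X 3 ^ e := by
  rw [monomial_eq, Finsupp.prod_fintype _ _ (by simp), Fin.prod_univ_four]
  simp

theorem negDegRevLexGT_of_degree_le {d : ℕ} {α β : Fin (d + 1) →₀ ℕ}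
    (h : α.degree ≤ β.degree) (h0 : α.degree = β.degree → α 0 < β 0) : NegDegRevLexGT α β :=
  h.lt_or_eq.imp id fun h => ⟨h, 0, fun j hj => absurd hj (Fin.not_lt_zero j), h0 h⟩

/-- If no monomial free of the least variable and not divisible by any `x ^ u i` exceeds a monomial
of the same weight, then (for Cohen-Macaulay tangent cones) every monomial not divisible by any
`x ^ u i` is the smallest one of its weight. -/
theorem negDegRevLexGT_of_normal {K : Type*} [Field K] {d : ℕ} {n : Fin (d + 1) → ℕ} {ι : Type*}
    {u : ι → Fin (d + 1) →₀ ℕ} (hpos : ∀ i, 0 < n i) (hmin : ∀ i ≠ 0, n 0 < n i)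
    (hCM : HasCohenMacaulayTangentCone K n)
    (h : ∀ ρ : Fin (d + 1) →₀ ℕ, ρ 0 = 0 → (∀ i, ¬ u i ≤ ρ) → ∀ δ,
      Finsupp.weight n δ = Finsupp.weight n ρ → ¬ NegDegRevLexGT ρ δ)
    (α : Fin (d + 1) →₀ ℕ) (hα : ∀ i, ¬ u i ≤ α) (β : Fin (d + 1) →₀ ℕ)
    (hβ : Finsupp.weight n β = Finsupp.weight n α) (hne : β ≠ α) : NegDegRevLexGT β α := by
  refine (NegDegRevLexGT.or_of_ne hne).resolve_right fun hgt => ?_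
  obtain ⟨ρ, hρ⟩ : ∃ ρ, α = Finsupp.single 0 (α 0) + ρ :=
    exists_add_of_le (Finsupp.single_le_iff.2 le_rfl)
  have hρ0 : ρ 0 = 0 := by
    have := DFunLike.congr_fun hρ 0
    simpa using this
  have hρu : ∀ i, ¬ u i ≤ ρ := fun i hi => hα i (hi.trans (hρ ▸ le_add_self))
  by_cases h0 : α 0 ≤ β 0
  · obtain ⟨δ, hδ⟩ : ∃ δ, β = Finsupp.single 0 (α 0) + δ :=
      exists_add_of_le (Finsupp.single_le_iff.2 h0)
    rw [hρ, hδ, map_add, map_add] at hβ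
    rw [hρ, hδ] at hgt
    exact h ρ hρ0 hρu δ (by omega) hgt.of_add_left
  · have hlt : α.degree < β.degree := by
      rcases hgt with hgt | ⟨-, i, hi, hlt⟩
      · exact hgt
      · exfalso
        rcases eq_or_ne i 0 with rfl | hi0
        · omega
        · have := hi 0 (Fin.pos_iff_ne_zero.2 hi0)
          omega
    have hmem := monomial_mem_tangentConeIdeal (K := K) hβ.symm hlt
    rw [hρ] at hmem
    obtain ⟨δ, hδ, hlt'⟩ := exists_weight_eq_degree_lt hpos hmin hCM ρ _ hmem
    exact h ρ hρ0 hρu δ hδ (Or.inl hlt')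

/-- The leading exponents of the five binomials, in the order in which they are usually written. -/
noncomputable def leftExponent (a₁ a₂ a₃ a₄ a₃₂ a₄₁ : ℕ) : Fin 5 → Fin 4 →₀ ℕ :=
  ![expo a₁ 0 0 0, expo 0 a₂ 0 0, expo 0 0 a₃ 0, expo 0 0 0 a₄, expo a₄₁ a₃₂ 0 0]

/-- The exponents subtracted in the five binomials. -/
noncomputable def rightExponent (a₁₂ a₁₃ a₂₁ a₂₄ a₃₂ a₃₄ a₄₁ a₄₃ : ℕ) : Fin 5 → Fin 4 →₀ ℕ :=
  ![expo 0 a₁₂ a₁₃ 0, expo a₂₁ 0 0 a₂₄, expo 0 a₃₂ 0 a₃₄, expo a₄₁ 0 a₄₃ 0, expo 0 0 a₁₃ a₂₄]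

/-- The toric ideal is generated by five binomials of Bresinsky's shape. -/
structure IsBresinskyPresentation (K : Type*) [Field K] (n : Fin 4 → ℕ)
    (a₁ a₂ a₃ a₄ a₁₂ a₁₃ a₂₁ a₂₄ a₃₂ a₃₄ a₄₁ a₄₃ : ℕ) : Prop where
  pos : ∀ i, 0 < n i
  strictMono : StrictMono n
  h₁₂ : 0 < a₁₂ ∧ a₁₂ < a₂
  h₁₃ : 0 < a₁₃ ∧ a₁₃ < a₃
  h₂₁ : 0 < a₂₁ ∧ a₂₁ < a₁
  h₂₄ : 0 < a₂₄ ∧ a₂₄ < a₄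
  h₃₂ : 0 < a₃₂ ∧ a₃₂ < a₂
  h₃₄ : 0 < a₃₄ ∧ a₃₄ < a₄
  h₄₁ : 0 < a₄₁ ∧ a₄₁ < a₁
  h₄₃ : 0 < a₄₃ ∧ a₄₃ < a₃
  span_eq : Ideal.span (Set.range fun i =>
    monomial (leftExponent a₁ a₂ a₃ a₄ a₃₂ a₄₁ i) (1 : K) -
      monomial (rightExponent a₁₂ a₁₃ a₂₁ a₂₄ a₃₂ a₃₄ a₄₁ a₄₃ i) 1) = toricIdeal K n

namespace IsBresinskyPresentation

variable {K : Type*} [Field K] {n : Fin 4 → ℕ}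
  {a₁ a₂ a₃ a₄ a₁₂ a₁₃ a₂₁ a₂₄ a₃₂ a₃₄ a₄₁ a₄₃ : ℕ}

theorem sub_mem_span
    (H : IsBresinskyPresentation K n a₁ a₂ a₃ a₄ a₁₂ a₁₃ a₂₁ a₂₄ a₃₂ a₃₄ a₄₁ a₄₃)
    {α β : Fin 4 →₀ ℕ} (h : Finsupp.weight n β = Finsupp.weight n α) :
    monomial α (1 : K) - monomial β 1 ∈ Ideal.span (Set.range fun i =>
      monomial (leftExponent a₁ a₂ a₃ a₄ a₃₂ a₄₁ i) (1 : K) -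
        monomial (rightExponent a₁₂ a₁₃ a₂₁ a₂₄ a₃₂ a₃₄ a₄₁ a₄₃ i) 1) := by
  rw [H.span_eq]; exact sub_mem_toricIdeal_iff.2 h.symm

theorem weight_eq
    (H : IsBresinskyPresentation K n a₁ a₂ a₃ a₄ a₁₂ a₁₃ a₂₁ a₂₄ a₃₂ a₃₄ a₄₁ a₄₃)
    (i : Fin 5) : Finsupp.weight n (leftExponent a₁ a₂ a₃ a₄ a₃₂ a₄₁ i) =
      Finsupp.weight n (rightExponent a₁₂ a₁₃ a₂₁ a₂₄ a₃₂ a₃₄ a₄₁ a₄₃ i) :=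
  (sub_mem_toricIdeal_iff (K := K)).1 (H.span_eq ▸ Ideal.subset_span ⟨i, rfl⟩)

theorem relations
    (H : IsBresinskyPresentation K n a₁ a₂ a₃ a₄ a₁₂ a₁₃ a₂₁ a₂₄ a₃₂ a₃₄ a₄₁ a₄₃) :
    a₁ * n 0 = a₁₂ * n 1 + a₁₃ * n 2 ∧ a₂ * n 1 = a₂₁ * n 0 + a₂₄ * n 3 ∧
    a₃ * n 2 = a₃₂ * n 1 + a₃₄ * n 3 ∧ a₄ * n 3 = a₄₁ * n 0 + a₄₃ * n 2 ∧
    a₄₁ * n 0 + a₃₂ * n 1 = a₁₃ * n 2 + a₂₄ * n 3 := by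
  refine ⟨?_, ?_, ?_, ?_, ?_⟩
  · simpa [leftExponent, rightExponent, weight_fin_four] using H.weight_eq 0
  · simpa [leftExponent, rightExponent, weight_fin_four] using H.weight_eq 1
  · simpa [leftExponent, rightExponent, weight_fin_four] using H.weight_eq 2
  · simpa [leftExponent, rightExponent, weight_fin_four] using H.weight_eq 3
  · simpa [leftExponent, rightExponent, weight_fin_four] using H.weight_eq 4

/-- A monomial free of `x₁` to which none of the five binomials applies is alone in its weight. -/
theorem eq_of_weight_eq
    (H : IsBresinskyPresentation K n a₁ a₂ a₃ a₄ a₁₂ a₁₃ a₂₁ a₂₄ a₃₂ a₃₄ a₄₁ a₄₃)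
    {α β : Fin 4 →₀ ℕ} (h : Finsupp.weight n β = Finsupp.weight n α)
    (e0 : α 0 = 0) (e1 : α 1 < a₂) (e2 : α 2 < a₃) (e3 : α 3 < a₄) (e4 : α 1 < a₁₂ ∨ α 2 < a₁₃)
    (e5 : α 1 < a₃₂ ∨ α 3 < a₃₄) (e6 : α 2 < a₁₃ ∨ α 3 < a₂₄) : β = α := by
  have := H.h₂₁; have := H.h₄₁
  refine eq_of_sub_mem_span (fun i => ?_) (fun i => ?_) (H.sub_mem_span h)
  · rw [le_fin_four, leftExponent]; fin_cases i <;> simp <;> omega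
  · rw [le_fin_four, rightExponent]; fin_cases i <;> simp <;> omega

theorem degree_lt
    (H : IsBresinskyPresentation K n a₁ a₂ a₃ a₄ a₁₂ a₁₃ a₂₁ a₂₄ a₃₂ a₃₄ a₄₁ a₄₃) :
    a₁₂ + a₁₃ < a₁ ∧ a₄ < a₄₁ + a₄₃ ∧ a₁₃ + a₂₄ < a₄₁ + a₃₂ := by
  obtain ⟨w1, -, -, w4, w5⟩ := H.relations
  have h01 : n 0 < n 1 := H.strictMono (by decide)
  have h12 : n 1 < n 2 := H.strictMono (by decide)
  have h23 : n 2 < n 3 := H.strictMono (by decide)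
  refine ⟨?_, ?_, ?_⟩ <;> by_contra! hcon
  · linarith [Nat.mul_le_mul_right (n 0) hcon, Nat.mul_lt_mul_of_pos_left h01 H.h₁₂.1,
      Nat.mul_lt_mul_of_pos_left (h01.trans h12) H.h₁₃.1]
  · linarith [Nat.mul_le_mul_right (n 3) hcon,
      Nat.mul_lt_mul_of_pos_left (h01.trans (h12.trans h23)) H.h₄₁.1,
      Nat.mul_lt_mul_of_pos_left h23 H.h₄₃.1]
  · linarith [Nat.mul_le_mul_right (n 1) hcon, Nat.mul_lt_mul_of_pos_left h01 H.h₄₁.1,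
      Nat.mul_lt_mul_of_pos_left h12 H.h₁₃.1, Nat.mul_lt_mul_of_pos_left (h12.trans h23) H.h₂₄.1]

theorem add_le_a₂
    (H : IsBresinskyPresentation K n a₁ a₂ a₃ a₄ a₁₂ a₁₃ a₂₁ a₂₄ a₃₂ a₃₄ a₄₁ a₄₃) :
    a₁₂ + a₃₂ ≤ a₂ := by
  have := H.h₁₂; have := H.h₁₃; have := H.h₂₄; have := H.h₃₂; have := H.h₃₄
  obtain ⟨w1, w2, w3, w4, w5⟩ := H.relations
  by_contra! hcon
  obtain ⟨b, rfl⟩ := Nat.exists_eq_add_of_lt H.h₃₂.2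
  have := H.eq_of_weight_eq (α := expo 0 (b + 1) a₁₃ 0) (β := expo (a₂₁ + a₄₁) 0 0 0)
    (by simp [weight_fin_four]; linarith)
    rfl (by simp; omega) (by simp; omega) (by simp; omega) (by simp; omega)
    (by simp; omega) (by simp; omega)
  have := DFunLike.congr_fun this 1
  simp at this

theorem add_le_a₄
    (H : IsBresinskyPresentation K n a₁ a₂ a₃ a₄ a₁₂ a₁₃ a₂₁ a₂₄ a₃₂ a₃₄ a₄₁ a₄₃) :
    a₂₄ + a₃₄ ≤ a₄ := by
  have := H.h₁₂; have := H.h₁₃; have := H.h₂₄; have := H.h₃₂; have := H.h₃₄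
  obtain ⟨w1, w2, w3, w4, w5⟩ := H.relations
  by_contra! hcon
  obtain ⟨k, hk⟩ := Nat.exists_eq_add_of_lt hcon
  have hk3 : (k + 1) * n 3 + a₄₃ * n 2 + a₁₃ * n 2 = a₃ * n 2 := by
    have : (a₂₄ + a₃₄) * n 3 = (a₄ + k + 1) * n 3 := by rw [hk]
    linarith
  have hlt : a₄₃ + a₁₃ < a₃ := by
    by_contra! hle
    linarith [Nat.mul_le_mul_right (n 2) hle, Nat.mul_pos k.succ_pos (H.pos 3)]
  obtain ⟨b, rfl⟩ := Nat.exists_eq_add_of_lt hlt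
  have := H.eq_of_weight_eq (α := expo 0 0 (b + 1) 0) (β := expo 0 0 0 (k + 1))
    (by simp [weight_fin_four]; linarith)
    rfl (by simp; omega) (by simp; omega) (by simp; omega) (by simp; omega)
    (by simp; omega) (by simp; omega)
  have := DFunLike.congr_fun this 2
  simp at this

theorem le_of_hasCohenMacaulayTangentCone
    (H : IsBresinskyPresentation K n a₁ a₂ a₃ a₄ a₁₂ a₁₃ a₂₁ a₂₄ a₃₂ a₃₄ a₄₁ a₄₃)
    (hCM : HasCohenMacaulayTangentCone K n) : a₂ ≤ a₂₁ + a₂₄ := by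
  have := H.h₁₂; have := H.h₁₃; have := H.h₂₄; have := H.h₃₂; have := H.h₃₄
  by_contra! hcon
  have hm := monomial_mem_tangentConeIdeal (K := K) (n := n)
    (α := Finsupp.single 0 a₂₁ + expo 0 0 0 a₂₄) (β := expo 0 a₂ 0 0)
    (by simp [weight_fin_four, H.relations.2.1]) (by simpa using hcon)
  obtain ⟨δ, hδ, hlt⟩ := exists_weight_eq_degree_lt H.pos
    (fun i hi => H.strictMono (Fin.pos_iff_ne_zero.2 hi)) hCM _ _ hm
  exact hlt.ne' (congrArg _ (H.eq_of_weight_eq hδ rfl (by simp; omega) (by simp; omega)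
    (by simp; omega) (by simp; omega) (by simp; omega) (by simp; omega)))

theorem add_le_of_hasCohenMacaulayTangentCone {c : ℕ}
    (H : IsBresinskyPresentation K n a₁ a₂ a₃ a₄ a₁₂ a₁₃ a₂₁ a₂₄ (a₁₂ + c) a₃₄ a₄₁ a₄₃)
    (hCM : HasCohenMacaulayTangentCone K n) : a₃ + a₁₃ ≤ a₁ + c + a₃₄ := by
  have := H.h₁₂; have := H.h₁₃; have := H.h₂₄; have := H.h₃₂; have := H.h₃₄
  obtain ⟨w1, -, w3, -, -⟩ := H.relations
  have w6 : (a₃ + a₁₃) * n 2 = a₁ * n 0 + c * n 1 + a₃₄ * n 3 := by linarith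
  by_contra! hcon
  have hm := monomial_mem_tangentConeIdeal (K := K) (n := n)
    (α := Finsupp.single 0 a₁ + expo 0 c 0 a₃₄) (β := expo 0 0 (a₃ + a₁₃) 0)
    (by simp [weight_fin_four, w6, add_assoc]) (by simpa [add_assoc] using hcon)
  obtain ⟨δ, hδ, hlt⟩ := exists_weight_eq_degree_lt H.pos
    (fun i hi => H.strictMono (Fin.pos_iff_ne_zero.2 hi)) hCM _ _ hm
  exact hlt.ne' (congrArg _ (H.eq_of_weight_eq hδ rfl (by simp; omega) (by simp; omega)
    (by simp; omega) (by simp; omega) (by simp; omega) (by simp; omega)))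

/-- A monomial free of `x₁` which is not divisible by any of the six leading monomials is the
smallest one of its weight. -/
theorem not_negDegRevLexGT
    (H : IsBresinskyPresentation K n a₁ a₂ a₃ a₄ a₁₂ a₁₃ a₂₁ a₂₄ a₃₂ a₃₄ a₄₁ a₄₃)
    (h₃ : a₃₂ + a₃₄ < a₃) {ρ δ : Fin 4 →₀ ℕ} (h0 : ρ 0 = 0)
    (h1 : ρ 1 < a₁₂ ∨ ρ 2 < a₁₃) (h2 : ρ 1 < a₂) (h3 : ρ 1 < a₃₂ ∨ ρ 3 < a₃₄) (h4 : ρ 3 < a₄)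
    (h5 : ρ 2 < a₁₃ ∨ ρ 3 < a₂₄) (h6 : ρ 2 < a₃ + a₁₃)
    (hδ : Finsupp.weight n δ = Finsupp.weight n ρ) : ¬ NegDegRevLexGT ρ δ := by
  intro hgt
  by_cases hρ2 : ρ 2 < a₃
  · rw [H.eq_of_weight_eq hδ h0 h2 hρ2 h4 h1 h3 h5] at hgt
    exact hgt.asymm hgt
  have hp2 : leftExponent a₁ a₂ a₃ a₄ a₃₂ a₄₁ 2 = expo 0 0 a₃ 0 := rfl
  have hq2 : rightExponent a₁₂ a₁₃ a₂₁ a₂₄ a₃₂ a₃₄ a₄₁ a₄₃ 2 = expo 0 a₃₂ 0 a₃₄ := rfl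
  obtain ⟨μ, rfl⟩ : ∃ μ, ρ = μ + leftExponent a₁ a₂ a₃ a₄ a₃₂ a₄₁ 2 :=
    ⟨_, (tsub_add_cancel_of_le (by rw [le_fin_four, hp2]; simp; omega)).symm⟩
  simp [hp2] at h0 h1 h2 h3 h4 h5 h6
  have := H.h₁₂; have := H.h₁₃; have := H.h₂₁; have := H.h₂₄; have := H.h₃₂; have := H.h₃₄
  have := H.h₄₁; have := H.h₄₃; have := H.add_le_a₂; have := H.add_le_a₄
  have hδ' := eq_or_eq_of_sub_mem_span (j := 2) (μ := μ)
    (fun i => by rw [le_fin_four, hp2, leftExponent]; fin_cases i <;> simp <;> omega)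
    (fun i => by rw [le_fin_four, hp2, rightExponent]; fin_cases i <;> simp <;> omega)
    (fun i => by rw [le_fin_four, hq2, leftExponent]; fin_cases i <;> simp <;> omega)
    (fun i => by rw [le_fin_four, hq2, rightExponent]; fin_cases i <;> simp <;> omega)
    (H.sub_mem_span hδ)
  rcases hδ' with h | h
  · rw [h] at hgt
    exact hgt.asymm hgt
  · have := hgt.degree_le
    rw [h, map_add, map_add, hp2, hq2] at this
    simp at this
    omega

end IsBresinskyPresentation

end FourVariables

end MonomialCurve

open MonomialCurve in
/- The variables `x_1, x_2, x_3, x_4` are `X 0, X 1, X 2, X 3`, and `n_1, ..., n_4` are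
`n 0, ..., n 3`. -/
theorem theorem2p18 {K : Type*} [Field K] (n : Fin 4 → ℕ)
    (hpos : ∀ i, 0 < n i) (hmono : StrictMono n) (hgcd : Finset.univ.gcd n = 1)
    (a₁ a₂ a₃ a₄ a₁₂ a₁₃ a₂₁ a₂₄ a₃₂ a₃₄ a₄₁ a₄₃ : ℕ)
    (h₁₂ : 0 < a₁₂ ∧ a₁₂ < a₂) (h₁₃ : 0 < a₁₃ ∧ a₁₃ < a₃)
    (h₂₁ : 0 < a₂₁ ∧ a₂₁ < a₁) (h₂₄ : 0 < a₂₄ ∧ a₂₄ < a₄)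
    (h₃₂ : 0 < a₃₂ ∧ a₃₂ < a₂) (h₃₄ : 0 < a₃₄ ∧ a₃₄ < a₄)
    (h₄₁ : 0 < a₄₁ ∧ a₄₁ < a₁) (h₄₃ : 0 < a₄₃ ∧ a₄₃ < a₃)
    (hI : MonomialCurve.IsMinimallyGeneratedBy (MonomialCurve.toricIdeal K n)
      ![X 0 ^ a₁ - X 1 ^ a₁₂ * X 2 ^ a₁₃,
        X 1 ^ a₂ - X 0 ^ a₂₁ * X 3 ^ a₂₄,
        X 2 ^ a₃ - X 1 ^ a₃₂ * X 3 ^ a₃₄,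
        X 3 ^ a₄ - X 0 ^ a₄₁ * X 2 ^ a₄₃,
        X 0 ^ a₄₁ * X 1 ^ a₃₂ - X 2 ^ a₁₃ * X 3 ^ a₂₄])
    (hCM : MonomialCurve.HasCohenMacaulayTangentCone K n)
    (h₃ : a₃₂ + a₃₄ < a₃) (h₃₄₂₄ : a₃₄ < a₂₄) (h₁₂₃₂ : a₁₂ ≤ a₃₂) :
    MonomialCurve.IsStandardBasis
      {X 0 ^ a₁ - X 1 ^ a₁₂ * X 2 ^ a₁₃,
        X 1 ^ a₂ - X 0 ^ a₂₁ * X 3 ^ a₂₄,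
        X 2 ^ a₃ - X 1 ^ a₃₂ * X 3 ^ a₃₄,
        X 3 ^ a₄ - X 0 ^ a₄₁ * X 2 ^ a₄₃,
        X 0 ^ a₄₁ * X 1 ^ a₃₂ - X 2 ^ a₁₃ * X 3 ^ a₂₄,
        X 2 ^ (a₃ + a₁₃) - X 0 ^ a₁ * X 1 ^ (a₃₂ - a₁₂) * X 3 ^ a₃₄}
      (MonomialCurve.toricIdeal K n) ∧
    (a₂ ≤ a₂₁ + a₂₄ ∧ a₃ + a₁₃ ≤ a₁ + (a₃₂ - a₁₂) + a₃₄) ∧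
    (a₂ < a₂₁ + a₂₄ → a₃ + a₁₃ < a₁ + (a₃₂ - a₁₂) + a₃₄ →
      MonomialCurve.IsMinimallyGeneratedBy
        (MonomialCurve.tangentConeIdeal (MonomialCurve.toricIdeal K n))
        ![X 1 ^ a₁₂ * X 2 ^ a₁₃, X 1 ^ a₂, X 1 ^ a₃₂ * X 3 ^ a₃₄, X 3 ^ a₄,
          X 2 ^ a₁₃ * X 3 ^ a₂₄, X 2 ^ (a₃ + a₁₃)]) ∧
    (a₂ < a₂₁ + a₂₄ → a₃ + a₁₃ = a₁ + (a₃₂ - a₁₂) + a₃₄ →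
      MonomialCurve.IsMinimallyGeneratedBy
        (MonomialCurve.tangentConeIdeal (MonomialCurve.toricIdeal K n))
        ![X 1 ^ a₁₂ * X 2 ^ a₁₃, X 1 ^ a₂, X 1 ^ a₃₂ * X 3 ^ a₃₄, X 3 ^ a₄,
          X 2 ^ a₁₃ * X 3 ^ a₂₄,
          X 2 ^ (a₃ + a₁₃) - X 0 ^ a₁ * X 1 ^ (a₃₂ - a₁₂) * X 3 ^ a₃₄]) ∧
    (a₂ = a₂₁ + a₂₄ → a₃ + a₁₃ < a₁ + (a₃₂ - a₁₂) + a₃₄ →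
      MonomialCurve.IsMinimallyGeneratedBy
        (MonomialCurve.tangentConeIdeal (MonomialCurve.toricIdeal K n))
        ![X 1 ^ a₁₂ * X 2 ^ a₁₃, X 1 ^ a₂ - X 0 ^ a₂₁ * X 3 ^ a₂₄,
          X 1 ^ a₃₂ * X 3 ^ a₃₄, X 3 ^ a₄, X 2 ^ a₁₃ * X 3 ^ a₂₄,
          X 2 ^ (a₃ + a₁₃)]) ∧
    (a₂ = a₂₁ + a₂₄ → a₃ + a₁₃ = a₁ + (a₃₂ - a₁₂) + a₃₄ →
      MonomialCurve.IsMinimallyGeneratedBy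
        (MonomialCurve.tangentConeIdeal (MonomialCurve.toricIdeal K n))
        ![X 1 ^ a₁₂ * X 2 ^ a₁₃, X 1 ^ a₂ - X 0 ^ a₂₁ * X 3 ^ a₂₄,
          X 1 ^ a₃₂ * X 3 ^ a₃₄, X 3 ^ a₄, X 2 ^ a₁₃ * X 3 ^ a₂₄,
          X 2 ^ (a₃ + a₁₃) - X 0 ^ a₁ * X 1 ^ (a₃₂ - a₁₂) * X 3 ^ a₃₄]) := by
  have H : IsBresinskyPresentation K n a₁ a₂ a₃ a₄ a₁₂ a₁₃ a₂₁ a₂₄ a₃₂ a₃₄ a₄₁ a₄₃ :=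
    { pos := hpos, strictMono := hmono, h₁₂, h₁₃, h₂₁, h₂₄, h₃₂, h₃₄, h₄₁, h₄₃
      span_eq := by
        rw [← hI.1]
        congr 2
        funext i
        fin_cases i <;> simp [leftExponent, rightExponent, monomial_expo] }
  obtain ⟨w1, w2, w3, w4, w5⟩ := H.relations
  obtain ⟨hd1, hd4, hd5⟩ := H.degree_lt
  have hd2 := H.le_of_hasCohenMacaulayTangentCone hCM
  obtain ⟨c, rfl⟩ := Nat.exists_eq_add_of_le h₁₂₃₂
  rw [Nat.add_sub_cancel_left]
  have hd6 := H.add_le_of_hasCohenMacaulayTangentCone hCM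
  clear hI hgcd hpos
  obtain ⟨u, hu⟩ : ∃ u : Fin 6 → Fin 4 →₀ ℕ, u = ![expo 0 a₁₂ a₁₃ 0, expo 0 a₂ 0 0,
    expo 0 (a₁₂ + c) 0 a₃₄, expo 0 0 0 a₄, expo 0 0 a₁₃ a₂₄, expo 0 0 (a₃ + a₁₃) 0] := ⟨_, rfl⟩
  obtain ⟨v, hv⟩ : ∃ v : Fin 6 → Fin 4 →₀ ℕ, v = ![expo a₁ 0 0 0, expo a₂₁ 0 0 a₂₄,
    expo 0 0 a₃ 0, expo a₄₁ 0 a₄₃ 0, expo a₄₁ (a₁₂ + c) 0 0, expo a₁ c 0 a₃₄] := ⟨_, rfl⟩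
  have hw : ∀ i, Finsupp.weight n (u i) = Finsupp.weight n (v i) := by
    intro i
    rw [hu, hv, weight_fin_four, weight_fin_four]
    fin_cases i <;> simp <;> linarith
  have hle : ∀ i, (u i).degree ≤ (v i).degree := by
    intro i
    rw [hu, hv]
    fin_cases i <;> simp <;> omega
  have hu₀ : ∀ i, u i 0 = 0 := by
    intro i
    rw [hu]
    fin_cases i <;> rfl
  have hv₀ : ∀ i, (u i).degree = (v i).degree → 0 < v i 0 := by
    intro i
    rw [hu, hv]
    fin_cases i <;> simp <;> omega
  have hu_ne : ∀ i j, i ≠ j → ¬ u i ≤ u j := by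
    intro i j
    rw [le_fin_four, hu]
    fin_cases i <;> fin_cases j <;> simp <;> omega
  have hgt : ∀ i, NegDegRevLexGT (u i) (v i) := fun i =>
    negDegRevLexGT_of_degree_le (hle i) fun h => by rw [hu₀]; exact hv₀ i h
  have hfree : ∀ ρ : Fin 4 →₀ ℕ, ρ 0 = 0 → (∀ i, ¬ u i ≤ ρ) → ∀ δ,
      Finsupp.weight n δ = Finsupp.weight n ρ → ¬ NegDegRevLexGT ρ δ := by
    intro ρ hρ0 hρ δ hδ
    simp only [le_fin_four, hu, Fin.forall_fin_succ] at hρ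
    simp [hρ0] at hρ
    exact H.not_negDegRevLexGT h₃ hρ0 (by omega) (by omega) (by omega) (by omega) (by omega)
      (by omega) hδ
  have hmin := negDegRevLexGT_of_normal H.pos
    (fun i hi => hmono (Fin.pos_iff_ne_zero.2 hi)) hCM hfree
  have hgen := isMinimallyGeneratedBy_binomialInitialForm (K := K) hw hle hu₀ hv₀ hu_ne hmin
  refine ⟨?_, ⟨hd2, hd6⟩, fun h2 h6 => ?_, fun h2 h6 => ?_, fun h2 h6 => ?_, fun h2 h6 => ?_⟩
  · convert isStandardBasis_of_normal (K := K) (f := ![X 0 ^ a₁ - X 1 ^ a₁₂ * X 2 ^ a₁₃,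
      X 1 ^ a₂ - X 0 ^ a₂₁ * X 3 ^ a₂₄, X 2 ^ a₃ - X 1 ^ (a₁₂ + c) * X 3 ^ a₃₄,
      X 3 ^ a₄ - X 0 ^ a₄₁ * X 2 ^ a₄₃, X 0 ^ a₄₁ * X 1 ^ (a₁₂ + c) - X 2 ^ a₁₃ * X 3 ^ a₂₄,
      X 2 ^ (a₃ + a₁₃) - X 0 ^ a₁ * X 1 ^ c * X 3 ^ a₃₄]) (fun i => ?_) hw hgt hmin using 1
    · simp only [Matrix.range_cons, Matrix.range_empty, Set.singleton_union, Set.union_empty]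
    · rw [hu, hv]
      fin_cases i <;> simp [monomial_expo]
  all_goals
    convert hgen using 1
    funext i
    rw [hu, hv]
    fin_cases i <;> simp [binomialInitialForm, monomial_expo] <;>
      first | omega | rw [if_neg (by omega), sub_zero]
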